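/- Let $H$ be a finite-dimensional $*$-Hopf algebra over $\mathbb{C}$, that is, a finite-dimensional Hopf algebra with antipode $\mathcal S$ together with a conjugate-linear involution $*$ that is antimultiplicative, $(xy)^*=y^*x^*$, and comultiplicative, $\Delta(x^*)=\sum x_1^*\otimes x_2^*$. Let $H^\vee$ be the dual Hopf algebra, with product $(\alpha\beta)(x)=\sum\alpha(x_1)\beta(x_2)$, unit $\varepsilon$, coproduct $\Delta(\alpha)=\sum\alpha_1\otimes\alpha_2$ determined by $\alpha(xy)=\sum\alpha_1(x)\alpha_2(y)$, counit $\alpha\mapsto\alpha(1)$ and antipode $\alpha\mapsto\alpha\circ\mathcal S$; with the involution $\alpha^*(x)=\overline{\alpha(\mathcal S(x)^*)}$ it is again a $*$-Hopf algebra. A $*$-Hopf algebra $K$ is called a compact quantum group (CQG) if every right $K$-comodule $V$ (of any dimension) admits an inner product $\langle\cdot,\cdot\rangle$, linear in the first and conjugate-linear in the second variable, such that $$\sum\langle u_0,v\rangle\,\mathcal S(u_1)=\sum\langle u,v_0\rangle\,v_1^*\qquad\text{for all }u,v\in V.$$ Then $H$ is a CQG if and only if $H^\vee$ is a CQG. 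-/

import Mathlib

open scoped TensorProduct ComplexConjugate

/-! ## Star Hopf algebras over the complex numbers -/

/-- A Hopf algebra `H` over `ℂ` with a conjugate linear, antimultiplicative involution (encoded by
`StarRing H` and `StarModule ℂ H`) is a `*`-Hopf algebra if the involution is comultiplicative:
`Δ(x^*) = ∑ x₁^* ⊗ x₂^*`. The star on `H ⊗ H` is the factorwise one. -/
class IsStarHopfAlgebra (H : Type*) [Ring H] [StarRing H] [HopfAlgebra ℂ H] : Prop
    extends StarModule ℂ H where
  comul_star : ∀ x : H,
    Coalgebra.comul (R := ℂ) (star x) = star (Coalgebra.comul (R := ℂ) x)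

/-- A right comodule structure `ρ : V → V ⊗ H` over the coalgebra underlying `H`. -/
structure RightComodule (H V : Type*) [Ring H] [HopfAlgebra ℂ H]
    [AddCommGroup V] [Module ℂ V] where
  coact : V →ₗ[ℂ] V ⊗[ℂ] H
  coassoc : (TensorProduct.assoc ℂ V H H).toLinearMap ∘ₗ coact.rTensor H ∘ₗ coact =
    (Coalgebra.comul (R := ℂ) (A := H)).lTensor V ∘ₗ coact
  counit_coact : (TensorProduct.rid ℂ V).toLinearMap ∘ₗ
    (Coalgebra.counit (R := ℂ) (A := H)).lTensor V ∘ₗ coact = LinearMap.id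

/-- A sesquilinear form, linear in the first and conjugate linear in the second variable, is an
inner product if it is hermitian and positive definite. -/
structure IsInnerProduct {V : Type*} [AddCommGroup V] [Module ℂ V]
    (B : V →ₗ[ℂ] V →ₗ⋆[ℂ] ℂ) : Prop where
  conj_symm : ∀ u v : V, conj (B u v) = B v u
  pos : ∀ u : V, u ≠ 0 → 0 < (B u u).re

section Invariance

variable {H V : Type*} [Ring H] [StarRing H] [HopfAlgebra ℂ H] [IsStarHopfAlgebra H]
  [AddCommGroup V] [Module ℂ V]

/-- The linear map `V ⊗ H → H`, `w ⊗ h ↦ ⟨w, v⟩ S(h)`. -/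
noncomputable def RightComodule.contractLeft (B : V →ₗ[ℂ] V →ₗ⋆[ℂ] ℂ) (v : V) : V ⊗[ℂ] H →ₗ[ℂ] H :=
  TensorProduct.lift <|
    LinearMap.mk₂ ℂ (fun w h => B w v • HopfAlgebra.antipode ℂ h)
      (fun w w' h => by simp [add_smul])
      (fun c w h => by simp [mul_smul])
      (fun w h h' => by simp)
      (fun c w h => by simp [smul_comm c])

/-- The conjugate linear map `V ⊗ H → H`, `w ⊗ h ↦ ⟨u, w⟩ h^*`. -/
noncomputable def RightComodule.contractRight (B : V →ₗ[ℂ] V →ₗ⋆[ℂ] ℂ) (u : V) : V ⊗[ℂ] H →ₗ⋆[ℂ] H :=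
  TensorProduct.lift <|
    LinearMap.mk₂'ₛₗ (starRingEnd ℂ) (starRingEnd ℂ) (fun w h => B u w • star h)
      (fun w w' h => by simp [add_smul])
      (fun c w h => by simp [mul_smul])
      (fun w h h' => by simp)
      (fun c w h => by simp [smul_comm (conj c)])

/-- Invariance of a sesquilinear form on a right comodule:
`∑ ⟨u₀, v⟩ S(u₁) = ∑ ⟨u, v₀⟩ v₁^*` for all `u, v`. -/
def RightComodule.IsInvariant (ρ : RightComodule H V) (B : V →ₗ[ℂ] V →ₗ⋆[ℂ] ℂ) : Prop :=
  ∀ u v : V, RightComodule.contractLeft (H := H) B v (ρ.coact u) = RightComodule.contractRight (H := H) B u (ρ.coact v)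

end Invariance

universe v u

/-- A `*`-Hopf algebra is a compact quantum group if every right comodule (of any dimension)
admits an invariant inner product. -/
def IsCQG (H : Type u) [Ring H] [StarRing H] [HopfAlgebra ℂ H] [IsStarHopfAlgebra H] : Prop :=
  ∀ (V : Type v) [AddCommGroup V] [Module ℂ V] (ρ : RightComodule H V),
    ∃ B : V →ₗ[ℂ] V →ₗ⋆[ℂ] ℂ, IsInnerProduct B ∧ ρ.IsInvariant B

/-! ## Facts about the antipode needed for the dual -/

namespace IsStarHopfAlgebra

variable {H : Type*} [Ring H] [StarRing H] [HopfAlgebra ℂ H] [IsStarHopfAlgebra H]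

theorem comul_star_repr {x : H} {ι : Type*} (r : Coalgebra.Repr ℂ x ι) :
    ∑ i ∈ r.index, star (r.left i) ⊗ₜ[ℂ] star (r.right i) =
      Coalgebra.comul (R := ℂ) (star x) := by
  rw [comul_star, ← r.eq, star_sum]
  simp

/-- The decomposition of `Δ(x^*)` induced by a decomposition of `Δ(x)`. -/
noncomputable def starRepr {x : H} {ι : Type*} (r : Coalgebra.Repr ℂ x ι) :
    Coalgebra.Repr ℂ (star x) ι where
  index := r.index
  left i := star (r.left i)
  right i := star (r.right i)
  eq := comul_star_repr r

theorem counit_star (x : H) :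
    Coalgebra.counit (R := ℂ) (star x) = conj (Coalgebra.counit (R := ℂ) x) := by
  let r := Coalgebra.Repr.arbitrary ℂ x
  have h1 : ∑ i ∈ r.index, conj (Coalgebra.counit (R := ℂ) (star (r.left i))) • r.right i = x := by
    have := congrArg star (Coalgebra.sum_counit_smul (starRepr r))
    simpa [starRepr, star_sum, star_smul] using this
  have h2 : ∑ i ∈ r.index, Coalgebra.counit (R := ℂ) (r.right i) • r.left i = x := by
    have := congrArg (TensorProduct.rid ℂ H) (Coalgebra.sum_tmul_counit_eq r)
    simpa only [map_sum, TensorProduct.rid_tmul, one_smul] using this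
  have h1' := congrArg (Coalgebra.counit (R := ℂ)) h1
  have h2' := congrArg (fun y => conj (Coalgebra.counit (R := ℂ) (star y))) h2
  simp only [map_sum, map_smul, smul_eq_mul, star_sum, star_smul, map_mul] at h1' h2'
  rw [← h1', map_sum]
  simp only [map_mul, Complex.conj_conj]
  have := congrArg conj h2'
  simp only [map_sum, map_mul, Complex.conj_conj, RCLike.star_def] at this
  rw [← this]
  exact Finset.sum_congr rfl fun i _ => mul_comm _ _

/-- `S ∘ * ∘ S ∘ * = id`. -/
theorem antipode_star_antipode_star (x : H) :
    HopfAlgebra.antipode ℂ (star (HopfAlgebra.antipode ℂ (star x))) = x := by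
  let T : H →ₗ[ℂ] H :=
    { toFun := fun x => HopfAlgebra.antipode ℂ (star (HopfAlgebra.antipode ℂ (star x)))
      map_add' := by simp
      map_smul' := by simp }
  have hT : WithConv.toConv (HopfAlgebra.antipode ℂ (A := H)) * WithConv.toConv T = 1 := by
    ext y
    let r := Coalgebra.Repr.arbitrary ℂ y
    have h := HopfAlgebra.sum_mul_antipode_eq_smul (starRepr r)
    have h' := congrArg (fun z => HopfAlgebra.antipode ℂ (star z)) h
    simp only [starRepr, star_sum, map_sum, star_mul, star_star,
      HopfAlgebra.antipode_mul_antidistrib, star_smul, star_one, map_smul,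
      HopfAlgebra.antipode_one, counit_star, RCLike.star_def, Complex.conj_conj] at h'
    rw [r.convMul_apply]
    refine h'.trans ?_
    simp [Algebra.algebraMap_eq_smul_one]
  have := left_inv_eq_right_inv LinearMap.id_mul_antipode hT
  exact congrArg (fun f : WithConv (H →ₗ[ℂ] H) => f x) this.symm

theorem star_antipode_star_antipode (x : H) :
    star (HopfAlgebra.antipode ℂ (star (HopfAlgebra.antipode ℂ x))) = x := by
  have := antipode_star_antipode_star (star x)
  rw [star_star] at this
  rw [this, star_star]

end IsStarHopfAlgebra

/-! ## The dual Hopf algebra -/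

/-- The space of linear functionals on `H`, as a type of its own to carry the dual Hopf algebra
structure. -/
def HopfDual (H : Type u) [Ring H] [HopfAlgebra ℂ H] : Type u := Module.Dual ℂ H

namespace HopfDual

variable {H : Type u} [Ring H] [HopfAlgebra ℂ H]

noncomputable instance : AddCommGroup (HopfDual H) :=
  inferInstanceAs (AddCommGroup (Module.Dual ℂ H))

noncomputable instance : Module ℂ (HopfDual H) :=
  inferInstanceAs (Module ℂ (Module.Dual ℂ H))

variable (H) in
/-- The identity map between `HopfDual H` and the dual vector space of `H`. -/
noncomputable def toDual : HopfDual H ≃ₗ[ℂ] Module.Dual ℂ H := LinearEquiv.refl ℂ _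

noncomputable instance : FunLike (HopfDual H) H ℂ where
  coe α := toDual H α
  coe_injective _ _ h := (toDual H).injective (DFunLike.coe_injective h)

instance : LinearMapClass (HopfDual H) ℂ H ℂ where
  map_add α := (toDual H α).map_add
  map_smulₛₗ α := (toDual H α).map_smul

@[ext] theorem ext {α β : HopfDual H} (h : ∀ x, α x = β x) : α = β := DFunLike.ext _ _ h

@[simp] theorem toDual_apply (α : HopfDual H) (x : H) : toDual H α x = α x := rfl
@[simp] theorem toDual_symm_apply (α : Module.Dual ℂ H) (x : H) : (toDual H).symm α x = α x := rfl
@[simp] theorem add_apply (α β : HopfDual H) (x : H) : (α + β) x = α x + β x := rfl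
@[simp] theorem smul_apply (c : ℂ) (α : HopfDual H) (x : H) : (c • α) x = c * α x := rfl
@[simp] theorem zero_apply (x : H) : (0 : HopfDual H) x = 0 := rfl

/-- The convolution product `(αβ)(x) = ∑ α(x₁) β(x₂)`. -/
noncomputable instance : Mul (HopfDual H) where
  mul α β := (toDual H).symm
    (TensorProduct.dualDistrib ℂ H H (toDual H α ⊗ₜ toDual H β) ∘ₗ Coalgebra.comul)

/-- The unit of the dual is the counit of `H`. -/
noncomputable instance : One (HopfDual H) where
  one := (toDual H).symm Coalgebra.counit

theorem mul_apply (α β : HopfDual H) (x : H) :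
    (α * β) x = TensorProduct.dualDistrib ℂ H H (toDual H α ⊗ₜ toDual H β)
      (Coalgebra.comul x) := rfl

theorem mul_apply_repr (α β : HopfDual H) {x : H} {ι : Type*} (r : Coalgebra.Repr ℂ x ι) :
    (α * β) x = ∑ i ∈ r.index, α (r.left i) * β (r.right i) := by
  simp [mul_apply, ← r.eq, map_sum]

@[simp] theorem one_apply (x : H) : (1 : HopfDual H) x = Coalgebra.counit (R := ℂ) x := rfl

theorem toConv_mul (α β : HopfDual H) :
    WithConv.toConv (toDual H (α * β)) =
      WithConv.toConv (toDual H α) * WithConv.toConv (toDual H β) := by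
  ext x
  rw [(Coalgebra.Repr.arbitrary ℂ x).convMul_apply]
  exact mul_apply_repr α β (Coalgebra.Repr.arbitrary ℂ x)

theorem toConv_one : WithConv.toConv (toDual H (1 : HopfDual H)) = 1 := by
  ext x; rfl

theorem toConv_injective : Function.Injective
    (fun α : HopfDual H => WithConv.toConv (toDual H α)) :=
  fun _ _ h => (toDual H).injective (WithConv.toConv_injective h)

noncomputable instance : Ring (HopfDual H) where
  __ := (inferInstance : AddCommGroup (HopfDual H))
  mul_assoc α β γ := toConv_injective (by simp only [toConv_mul, mul_assoc])
  one_mul α := toConv_injective (by simp only [toConv_mul, toConv_one, one_mul])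
  mul_one α := toConv_injective (by simp only [toConv_mul, toConv_one, mul_one])
  zero_mul α := by ext x; simp [mul_apply]
  mul_zero α := by ext x; simp [mul_apply]
  left_distrib α β γ := by ext x; simp [mul_apply, TensorProduct.tmul_add]
  right_distrib α β γ := by ext x; simp [mul_apply, TensorProduct.add_tmul]

noncomputable instance : Algebra ℂ (HopfDual H) :=
  Algebra.ofModule
    (fun c α β => by ext x; simp [mul_apply, ← TensorProduct.smul_tmul'])
    (fun c α β => by ext x; simp [mul_apply])


/-- Evaluation in the first tensor factor. -/
noncomputable def evalFst (M : Type*) [AddCommGroup M] [Module ℂ M] (x : H) :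
    HopfDual H ⊗[ℂ] M →ₗ[ℂ] M :=
  (TensorProduct.lid ℂ M).toLinearMap ∘ₗ
    ((Module.Dual.eval ℂ H x) ∘ₗ (toDual H).toLinearMap).rTensor M

@[simp] theorem evalFst_tmul {M : Type*} [AddCommGroup M] [Module ℂ M] (x : H) (α : HopfDual H)
    (m : M) : evalFst M x (α ⊗ₜ m) = α x • m := by
  simp [evalFst]

/-- `α(x · )` as a functional. -/
noncomputable def mulLeft (x : H) : HopfDual H →ₗ[ℂ] HopfDual H :=
  (toDual H).symm.toLinearMap ∘ₗ (LinearMap.mulLeft ℂ x).dualMap ∘ₗ (toDual H).toLinearMap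

@[simp] theorem mulLeft_apply (x y : H) (α : HopfDual H) : mulLeft x α y = α (x * y) := rfl

theorem evalFst_lTensor {M N : Type*} [AddCommGroup M] [Module ℂ M] [AddCommGroup N] [Module ℂ N]
    (f : M →ₗ[ℂ] N) (x : H) (s : HopfDual H ⊗[ℂ] M) :
    evalFst N x (f.lTensor _ s) = f (evalFst M x s) := by
  induction s with
  | zero => simp
  | tmul α m => simp
  | add a b ha hb => simp [ha, hb]

theorem evalFst_rTensor_mulLeft (x y : H) (s : HopfDual H ⊗[ℂ] HopfDual H) :
    evalFst _ y ((mulLeft x).rTensor (HopfDual H) s) = evalFst _ (x * y) s := by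
  induction s with
  | zero => simp
  | tmul α β => simp
  | add a b ha hb => simp [ha, hb]

section Finite

variable [Module.Finite ℂ H]

variable (H) in
/-- The canonical isomorphism of the tensor square of the dual with the dual of the tensor
square, `(α ⊗ β)(x ⊗ y) = α(x) β(y)`. -/
noncomputable def tensorEquiv :
    HopfDual H ⊗[ℂ] HopfDual H ≃ₗ[ℂ] Module.Dual ℂ (H ⊗[ℂ] H) :=
  (TensorProduct.congr (toDual H) (toDual H)).trans (TensorProduct.dualDistribEquiv ℂ H H)

/-- The coalgebra structure of the dual: `Δ(α) = ∑ α₁ ⊗ α₂` with `α(xy) = ∑ α₁(x) α₂(y)`, and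
`ε(α) = α(1)`. -/
noncomputable instance : CoalgebraStruct ℂ (HopfDual H) where
  comul := (tensorEquiv H).symm.toLinearMap ∘ₗ (LinearMap.mul' ℂ H).dualMap ∘ₗ
    (toDual H).toLinearMap
  counit := (Module.Dual.eval ℂ H 1) ∘ₗ (toDual H).toLinearMap

@[simp] theorem tensorEquiv_tmul (α β : HopfDual H) (x y : H) :
    tensorEquiv H (α ⊗ₜ β) (x ⊗ₜ y) = α x * β y := by
  simp [tensorEquiv, TensorProduct.dualDistribEquiv, TensorProduct.dualDistribEquivOfBasis]

@[simp] theorem counit_apply (α : HopfDual H) : Coalgebra.counit (R := ℂ) α = α 1 := rfl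

@[simp] theorem tensorEquiv_comul (α : HopfDual H) (x y : H) :
    tensorEquiv H (Coalgebra.comul (R := ℂ) α) (x ⊗ₜ y) = α (x * y) := by
  change tensorEquiv H ((tensorEquiv H).symm _) _ = _
  rw [LinearEquiv.apply_symm_apply]
  rfl

theorem ext_evalFst {M : Type*} [AddCommGroup M] [Module ℂ M] {s t : HopfDual H ⊗[ℂ] M}
    (h : ∀ x, evalFst M x s = evalFst M x t) : s = t := by
  have key : ∀ (r : HopfDual H ⊗[ℂ] M) (x : H),
      dualTensorHomEquiv ℂ H M (TensorProduct.congr (toDual H) (LinearEquiv.refl ℂ M) r) x =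
        evalFst M x r := by
    intro r x
    induction r with
    | zero => simp
    | tmul α m => simp
    | add a b ha hb => simp only [map_add, LinearMap.add_apply, ha, hb]
  refine ((TensorProduct.congr (toDual H) (LinearEquiv.refl ℂ M)).trans
    (dualTensorHomEquiv ℂ H M)).injective (LinearMap.ext fun x => ?_)
  exact (key s x).trans ((h x).trans (key t x).symm)

theorem ext_tensor {s t : HopfDual H ⊗[ℂ] HopfDual H}
    (h : ∀ x y, tensorEquiv H s (x ⊗ₜ y) = tensorEquiv H t (x ⊗ₜ y)) : s = t :=
  (tensorEquiv H).injective (TensorProduct.ext' h)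

theorem evalFst_apply (s : HopfDual H ⊗[ℂ] HopfDual H) (x y : H) :
    (evalFst _ x s) y = tensorEquiv H s (x ⊗ₜ y) := by
  induction s with
  | zero => simp
  | tmul α β => simp
  | add a b ha hb => simp [ha, hb]

theorem evalFst_comul (x : H) (α : HopfDual H) :
    evalFst _ x (Coalgebra.comul (R := ℂ) α) = mulLeft x α := by
  ext y
  simp [evalFst_apply]

theorem evalFst_assoc (x : H) (s : HopfDual H ⊗[ℂ] HopfDual H) :
    evalFst _ x (TensorProduct.assoc ℂ _ _ _
      ((Coalgebra.comul (R := ℂ) (A := HopfDual H)).rTensor (HopfDual H) s)) =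
      (mulLeft x).rTensor (HopfDual H) s := by
  induction s with
  | zero => simp
  | add a b ha hb => simp [ha, hb]
  | tmul α β =>
    rw [LinearMap.rTensor_tmul, LinearMap.rTensor_tmul, ← evalFst_comul]
    generalize Coalgebra.comul (R := ℂ) α = t
    induction t with
    | zero => simp
    | add a b ha hb => simp [ha, hb, TensorProduct.add_tmul]
    | tmul γ δ => simp [TensorProduct.smul_tmul']

noncomputable instance : Coalgebra ℂ (HopfDual H) where
  coassoc := by
    ext1 α
    refine ext_evalFst fun x => ext_evalFst fun y => ?_
    simp only [LinearMap.comp_apply, LinearEquiv.coe_coe]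
    rw [evalFst_assoc, evalFst_rTensor_mulLeft, evalFst_lTensor, evalFst_comul, evalFst_comul,
      evalFst_comul]
    ext z
    simp [mul_assoc]
  rTensor_counit_comp_comul := by
    ext1 α
    apply (TensorProduct.lid ℂ (HopfDual H)).injective
    change evalFst _ 1 (Coalgebra.comul (R := ℂ) α) = _
    rw [evalFst_comul]
    ext z
    simp
  lTensor_counit_comp_comul := by
    ext1 α
    refine ext_evalFst fun x => ?_
    simp only [LinearMap.comp_apply]
    rw [evalFst_lTensor, evalFst_comul]
    simp

theorem tensorEquiv_mul (s t : HopfDual H ⊗[ℂ] HopfDual H) {x y : H} {ι κ : Type*}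
    (r : Coalgebra.Repr ℂ x ι) (q : Coalgebra.Repr ℂ y κ) :
    tensorEquiv H (s * t) (x ⊗ₜ y) = ∑ i ∈ r.index, ∑ j ∈ q.index,
      tensorEquiv H s (r.left i ⊗ₜ q.left j) * tensorEquiv H t (r.right i ⊗ₜ q.right j) := by
  induction s with
  | zero => simp
  | add a b ha hb => simp [add_mul, ha, hb, Finset.sum_add_distrib]
  | tmul α β =>
    induction t with
    | zero => simp
    | add a b ha hb => simp [mul_add, ha, hb, Finset.sum_add_distrib]
    | tmul γ δ =>
      simp [mul_apply_repr _ _ r, mul_apply_repr _ _ q, Finset.sum_mul_sum, mul_mul_mul_comm]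

noncomputable instance : Bialgebra ℂ (HopfDual H) :=
  Bialgebra.mk' ℂ (HopfDual H)
    (by simp)
    (by
      intro α β
      simp [mul_apply, Algebra.TensorProduct.one_def])
    (by
      refine ext_tensor fun x y => ?_
      simp [Algebra.TensorProduct.one_def])
    (by
      intro α β
      refine ext_tensor fun x y => ?_
      rw [tensorEquiv_mul _ _ (Coalgebra.Repr.arbitrary ℂ x) (Coalgebra.Repr.arbitrary ℂ y)]
      rw [tensorEquiv_comul, mul_apply, Bialgebra.comul_mul,
        ← (Coalgebra.Repr.arbitrary ℂ x).eq, ← (Coalgebra.Repr.arbitrary ℂ y).eq]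
      simp [Finset.sum_mul_sum])

/-- The antipode of the dual: `S(α)(x) = α(S(x))`. -/
noncomputable instance : HopfAlgebraStruct ℂ (HopfDual H) where
  antipode := (toDual H).symm.toLinearMap ∘ₗ (HopfAlgebra.antipode ℂ (A := H)).dualMap ∘ₗ
    (toDual H).toLinearMap

@[simp] theorem antipode_apply (α : HopfDual H) (x : H) :
    (HopfAlgebra.antipode ℂ α) x = α (HopfAlgebra.antipode ℂ x) := rfl

theorem mul'_rTensor_apply (f : H →ₗ[ℂ] H) (g : HopfDual H →ₗ[ℂ] HopfDual H)
    (hg : ∀ α x, g α x = α (f x)) (s : HopfDual H ⊗[ℂ] HopfDual H) (x : H) :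
    (LinearMap.mul' ℂ (HopfDual H) (g.rTensor _ s)) x =
      tensorEquiv H s (f.rTensor H (Coalgebra.comul x)) := by
  induction s with
  | zero => simp
  | add a b ha hb => simp [ha, hb]
  | tmul α β =>
    simp [mul_apply_repr _ _ (Coalgebra.Repr.arbitrary ℂ x), hg,
      ← (Coalgebra.Repr.arbitrary ℂ x).eq]

theorem mul'_lTensor_apply (f : H →ₗ[ℂ] H) (g : HopfDual H →ₗ[ℂ] HopfDual H)
    (hg : ∀ α x, g α x = α (f x)) (s : HopfDual H ⊗[ℂ] HopfDual H) (x : H) :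
    (LinearMap.mul' ℂ (HopfDual H) (g.lTensor _ s)) x =
      tensorEquiv H s (f.lTensor H (Coalgebra.comul x)) := by
  induction s with
  | zero => simp
  | add a b ha hb => simp [ha, hb]
  | tmul α β =>
    simp [mul_apply_repr _ _ (Coalgebra.Repr.arbitrary ℂ x), hg,
      ← (Coalgebra.Repr.arbitrary ℂ x).eq]

theorem tensorEquiv_comul' (α : HopfDual H) (s : H ⊗[ℂ] H) :
    tensorEquiv H (Coalgebra.comul (R := ℂ) α) s = α (LinearMap.mul' ℂ H s) := by
  induction s with
  | zero => simp
  | tmul x y => simp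
  | add a b ha hb => simp [ha, hb]

noncomputable instance : HopfAlgebra ℂ (HopfDual H) where
  mul_antipode_rTensor_comul := by
    ext α x
    simp only [LinearMap.comp_apply]
    rw [mul'_rTensor_apply (HopfAlgebra.antipode ℂ) _ antipode_apply, tensorEquiv_comul']
    simp [Algebra.algebraMap_eq_smul_one, mul_comm]
  mul_antipode_lTensor_comul := by
    ext α x
    simp only [LinearMap.comp_apply]
    rw [mul'_lTensor_apply (HopfAlgebra.antipode ℂ) _ antipode_apply, tensorEquiv_comul']
    simp [Algebra.algebraMap_eq_smul_one, mul_comm]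

end Finite

section Star

variable [StarRing H] [IsStarHopfAlgebra H]

/-- The involution of the dual: the functional `α^*(x) = conj (α(S(x)^*))`. -/
noncomputable def starFun (α : HopfDual H) : HopfDual H :=
  (toDual H).symm
    { toFun := fun x => conj (α (star (HopfAlgebra.antipode ℂ x)))
      map_add' := by simp
      map_smul' := by simp }

theorem starFun_apply (α : HopfDual H) (x : H) :
    starFun α x = conj (α (star (HopfAlgebra.antipode ℂ x))) := rfl

/-- The functional `x ↦ conj (α(x^*))`. -/
noncomputable def conjStar (α : HopfDual H) : HopfDual H :=
  (toDual H).symm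
    { toFun := fun x => conj (α (star x))
      map_add' := by simp
      map_smul' := by simp }

theorem conjStar_apply (α : HopfDual H) (x : H) : conjStar α x = conj (α (star x)) := rfl

theorem conjStar_mul (α β : HopfDual H) : conjStar (α * β) = conjStar α * conjStar β := by
  ext x
  let r := Coalgebra.Repr.arbitrary ℂ x
  rw [conjStar_apply, mul_apply_repr _ _ (IsStarHopfAlgebra.starRepr r), mul_apply_repr _ _ r]
  simp [IsStarHopfAlgebra.starRepr, conjStar_apply]

variable [Module.Finite ℂ H]

theorem starFun_eq (α : HopfDual H) : starFun α = HopfAlgebra.antipode ℂ (conjStar α) := rfl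

noncomputable instance : StarRing (HopfDual H) where
  star := starFun
  star_involutive α := by
    ext x
    simp [starFun_apply, IsStarHopfAlgebra.star_antipode_star_antipode]
  star_add α β := by ext x; simp [starFun_apply]
  star_mul α β := by
    simp only [starFun_eq, conjStar_mul, HopfAlgebra.antipode_mul_antidistrib]

@[simp] theorem star_apply (α : HopfDual H) (x : H) :
    star α x = conj (α (star (HopfAlgebra.antipode ℂ x))) := rfl

instance : StarModule ℂ (HopfDual H) where
  star_smul c α := by ext x; simp

instance : IsStarHopfAlgebra (HopfDual H) where
  comul_star α := by
    have key : ∀ (s : HopfDual H ⊗[ℂ] HopfDual H) (x y : H), tensorEquiv H (star s) (x ⊗ₜ y) =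
        conj (tensorEquiv H s (star (HopfAlgebra.antipode ℂ x) ⊗ₜ
          star (HopfAlgebra.antipode ℂ y))) := by
      intro s x y
      induction s with
      | zero => simp
      | tmul α β => simp
      | add a b ha hb => simp [ha, hb]
    refine ext_tensor fun x y => ?_
    rw [key, tensorEquiv_comul, tensorEquiv_comul, star_apply,
      HopfAlgebra.antipode_mul_antidistrib, star_mul]

end Star

end HopfDual

/-! For a finite-dimensional `*`-Hopf algebra `K`, being a CQG comes from a single faithful positive
functional on `K`, and such a functional is what the CQG property of the dual supplies.

From `H` to its dual (`IsCQG.exists_isFaithfulPositive`): an invariant inner product on the regular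
comodule `H` says exactly that the dual acts on `H` by a `*`-representation. This representation is
faithful, because `ε(β · x) = β(x)`, so summing `⟨β · b, b⟩` over a basis gives a faithful positive
functional on the dual.

From a functional to the CQG property (`IsFaithfulPositive.isCQG`): positivity passes to the trace
of the regular representation. Because `x ⊗ 1` and `Δ(x)` act by conjugate operators on `K ⊗ K`, the
normalised trace `h` satisfies `(h ⊗ h)Δ = h`. A norm computation upgrades this to invariance, so
`h` is a Haar functional. Every comodule `V` embeds through its coaction in the cofree comodule `V ⊗
K`, where any inner product on `V` tensored with `h(b^* a)` is invariant.

The converse is the same argument for the dual, which yields a functional on the double dual;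
evaluation is an injective `*`-homomorphism from `H`, so the functional pulls back. -/

/-! ## Inner products -/

namespace IsInnerProduct

section

variable {V : Type*} [AddCommGroup V] [Module ℂ V]

/-- The inner product space core attached to an inner product. -/
@[reducible] noncomputable def core {B : V →ₗ[ℂ] V →ₗ⋆[ℂ] ℂ} (hB : IsInnerProduct B) :
    InnerProductSpace.Core ℂ V where
  -- The arguments are swapped because Mathlib's `inner` is conjugate-linear in the first variable.
  inner u v := B v u
  conj_inner_symm u v := hB.conj_symm u v
  re_inner_nonneg u := by
    by_cases hu : u = 0
    · simp [hu]
    · exact (hB.pos u hu).le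
  add_left u v w := by simp
  smul_left u v r := by simp
  definite u hu := by
    by_contra h
    have := hB.pos u h
    rw [hu] at this
    simp at this

theorem of_innerProductSpace (E : Type*) [NormedAddCommGroup E] [InnerProductSpace ℂ E] :
    IsInnerProduct (innerₛₗ ℂ (E := E)).flip where
  conj_symm u v := by simp
  pos u hu := by
    simp only [LinearMap.flip_apply, innerₛₗ_apply_apply]
    exact (inner_self_nonneg (𝕜 := ℂ) (x := u)).lt_of_ne' fun h =>
      hu (inner_self_eq_zero.1 (Complex.ext h (by simpa using inner_self_im (𝕜 := ℂ) u)))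

/-- The basis is orthonormal for `B`, but only the trace formula is needed later. -/
theorem exists_basis_trace [FiniteDimensional ℂ V] {B : V →ₗ[ℂ] V →ₗ⋆[ℂ] ℂ}
    (hB : IsInnerProduct B) :
    ∃ (n : ℕ) (e : Module.Basis (Fin n) ℂ V), ∀ T : V →ₗ[ℂ] V,
      LinearMap.trace ℂ V T = ∑ i, B (T (e i)) (e i) := by
  let := hB.core
  let : NormedAddCommGroup V := InnerProductSpace.Core.toNormedAddCommGroup (𝕜 := ℂ)
  let : InnerProductSpace ℂ V := InnerProductSpace.ofCore _
  let b := stdOrthonormalBasis ℂ V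
  exact ⟨_, b.toBasis, fun T => by
    rw [LinearMap.trace_eq_sum_inner T b, b.coe_toBasis]
    rfl⟩

theorem exists_tensor {W : Type*} [AddCommGroup W] [Module ℂ W]
    {B : V →ₗ[ℂ] V →ₗ⋆[ℂ] ℂ} {C : W →ₗ[ℂ] W →ₗ⋆[ℂ] ℂ}
    (hB : IsInnerProduct B) (hC : IsInnerProduct C) :
    ∃ D : V ⊗[ℂ] W →ₗ[ℂ] V ⊗[ℂ] W →ₗ⋆[ℂ] ℂ, IsInnerProduct D ∧
      ∀ v w v' w', D (v ⊗ₜ w) (v' ⊗ₜ w') = B v v' * C w w' := by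
  let := hB.core
  let : NormedAddCommGroup V := InnerProductSpace.Core.toNormedAddCommGroup (𝕜 := ℂ)
  let : InnerProductSpace ℂ V := InnerProductSpace.ofCore _
  let := hC.core
  let : NormedAddCommGroup W := InnerProductSpace.Core.toNormedAddCommGroup (𝕜 := ℂ)
  let : InnerProductSpace ℂ W := InnerProductSpace.ofCore _
  exact ⟨_, of_innerProductSpace (V ⊗[ℂ] W), fun _ _ _ _ => rfl⟩

/-- Pullback of a sesquilinear form along a linear map. -/
noncomputable def _root_.LinearMap.sesqPullback {W : Type*} [AddCommGroup W] [Module ℂ W]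
    (B : W →ₗ[ℂ] W →ₗ⋆[ℂ] ℂ) (f : V →ₗ[ℂ] W) : V →ₗ[ℂ] V →ₗ⋆[ℂ] ℂ :=
  LinearMap.mk₂'ₛₗ (RingHom.id ℂ) (starRingEnd ℂ) (fun u v => B (f u) (f v))
    (by simp) (by simp) (by simp) (by simp)

@[simp] theorem _root_.LinearMap.sesqPullback_apply {W : Type*} [AddCommGroup W] [Module ℂ W]
    (B : W →ₗ[ℂ] W →ₗ⋆[ℂ] ℂ) (f : V →ₗ[ℂ] W) (u v : V) :
    B.sesqPullback f u v = B (f u) (f v) := rfl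

theorem pullback {W : Type*} [AddCommGroup W] [Module ℂ W] {B : W →ₗ[ℂ] W →ₗ⋆[ℂ] ℂ}
    (hB : IsInnerProduct B) {f : V →ₗ[ℂ] W} (hf : Function.Injective f) :
    IsInnerProduct (B.sesqPullback f) where
  conj_symm _ _ := hB.conj_symm _ _
  pos _ hu := hB.pos _ ((map_ne_zero_iff f hf).2 hu)

end

theorem exists_of_finsupp (ι : Type*) :
    ∃ B : (ι →₀ ℂ) →ₗ[ℂ] (ι →₀ ℂ) →ₗ⋆[ℂ] ℂ, IsInnerProduct B := by
  classical
  refine ⟨LinearMap.mk₂'ₛₗ (RingHom.id ℂ) (starRingEnd ℂ)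
    (fun f g => Finsupp.linearCombination ℂ (fun i => conj (g i)) f)
    (by simp) (by simp) (fun f g h => ?_) (fun c f g => ?_), fun f g => ?_, fun f hf => ?_⟩
  · simp [Finsupp.linearCombination_apply, Finsupp.sum, mul_add, Finset.sum_add_distrib]
  · simp [Finsupp.linearCombination_apply, Finsupp.sum, Finset.mul_sum, mul_left_comm]
  -- Summing over the union of the supports makes the expression symmetric in `f` and `g`.
  · have key : ∀ p q : ι →₀ ℂ, p.support ⊆ f.support ∪ g.support →
        Finsupp.linearCombination ℂ (fun i => conj (q i)) p =
          ∑ i ∈ f.support ∪ g.support, p i * conj (q i) := fun p q hp => by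
      rw [Finsupp.linearCombination_apply, Finsupp.sum_of_support_subset _ hp _ (by simp)]
      simp
    simp only [LinearMap.mk₂'ₛₗ_apply]
    rw [key f g Finset.subset_union_left, key g f Finset.subset_union_right, map_sum]
    simp [mul_comm]
  · simp only [LinearMap.mk₂'ₛₗ_apply, Finsupp.linearCombination_apply, Finsupp.sum, smul_eq_mul,
      Complex.mul_conj, Complex.re_sum, Complex.ofReal_re]
    exact Finset.sum_pos (fun i hi => Complex.normSq_pos.2 (Finsupp.mem_support_iff.1 hi))
      (Finsupp.support_nonempty_iff.2 hf)

theorem exists_isInnerProduct (V : Type*) [AddCommGroup V] [Module ℂ V] :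
    ∃ B : V →ₗ[ℂ] V →ₗ⋆[ℂ] ℂ, IsInnerProduct B := by
  obtain ⟨B, hB⟩ := exists_of_finsupp (Module.Basis.ofVectorSpaceIndex ℂ V)
  exact ⟨_, hB.pullback (Module.Basis.ofVectorSpace ℂ V).repr.injective⟩

end IsInnerProduct

/-! ## Faithful positive functionals -/

/-- The trace of the left regular representation. -/
noncomputable def regularTrace (K : Type*) [Ring K] [Algebra ℂ K] : K →ₗ[ℂ] ℂ :=
  LinearMap.trace ℂ K ∘ₗ (Algebra.lmul ℂ K).toLinearMap

theorem regularTrace_apply {K : Type*} [Ring K] [Algebra ℂ K] (a : K) :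
    regularTrace K a = LinearMap.trace ℂ K (LinearMap.mulLeft ℂ a) := rfl

/-- A linear functional on a `*`-algebra is faithful and positive if it is hermitian and strictly
positive on the elements `a^* a` with `a ≠ 0`. -/
structure IsFaithfulPositive {K : Type*} [Ring K] [StarRing K] [Algebra ℂ K]
    (f : K →ₗ[ℂ] ℂ) : Prop where
  map_star : ∀ a : K, f (star a) = conj (f a)
  pos : ∀ a : K, a ≠ 0 → 0 < (f (star a * a)).re

namespace IsFaithfulPositive

theorem smul {K : Type*} [Ring K] [StarRing K] [Algebra ℂ K]
    {f : K →ₗ[ℂ] ℂ} (hf : IsFaithfulPositive f) {r : ℝ} (hr : 0 < r) :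
    IsFaithfulPositive ((r : ℂ) • f) where
  map_star a := by simp [hf.map_star]
  pos a ha := by simpa using mul_pos hr (hf.pos a ha)

section Algebra

variable {K : Type*} [Ring K] [StarRing K] [Algebra ℂ K] [StarModule ℂ K]

/-- The sesquilinear form `⟨a, b⟩ = f(b^* a)`. -/
noncomputable def form (f : K →ₗ[ℂ] ℂ) : K →ₗ[ℂ] K →ₗ⋆[ℂ] ℂ :=
  LinearMap.mk₂'ₛₗ (RingHom.id ℂ) (starRingEnd ℂ) (fun a b => f (star b * a))
    (by simp [mul_add]) (by simp) (by simp [add_mul]) (by simp)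

@[simp] theorem form_apply (f : K →ₗ[ℂ] ℂ) (a b : K) : form f a b = f (star b * a) := rfl

theorem isInnerProduct {f : K →ₗ[ℂ] ℂ} (hf : IsFaithfulPositive f) :
    IsInnerProduct (form f) where
  conj_symm a b := by simp [← hf.map_star]
  pos a ha := hf.pos a ha

/-- In a basis orthonormal for `f(b^* a)`, the trace of left multiplication by `a` is `∑ f(eᵢ^* a
eᵢ)`. At `a^* a` this is a sum of squared norms of the `a eᵢ`, not all zero when `a ≠ 0`. Unlike
`f`, the trace has a computable behaviour under `Δ`. -/
theorem trace [FiniteDimensional ℂ K] {f : K →ₗ[ℂ] ℂ} (hf : IsFaithfulPositive f) :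
    IsFaithfulPositive (regularTrace K) := by
  obtain ⟨n, e, he⟩ := hf.isInnerProduct.exists_basis_trace
  have htr : ∀ a, regularTrace K a = ∑ i, f (star (e i) * (a * e i)) := fun a => by
    rw [regularTrace_apply, he]
    rfl
  refine ⟨fun a => ?_, fun a ha => ?_⟩
  · rw [htr, htr, map_sum]
    refine Finset.sum_congr rfl fun i _ => ?_
    rw [← hf.map_star]
    simp [mul_assoc]
  · have hsq : ∀ i, star (e i) * (star a * a * e i) = star (a * e i) * (a * e i) := fun i => by
      simp [mul_assoc]
    have hnn : ∀ b, 0 ≤ (f (star b * b)).re := fun b => by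
      by_cases hb : b = 0
      · simp [hb]
      · exact (hf.pos b hb).le
    rw [htr, Complex.re_sum]
    simp only [hsq]
    obtain ⟨i, hi⟩ : ∃ i, a * e i ≠ 0 := by
      by_contra! h
      have : LinearMap.mulLeft ℂ a = 0 := e.ext fun i => by simp [h i]
      exact ha (by simpa using LinearMap.congr_fun this 1)
    exact Finset.sum_pos' (fun i _ => hnn _) ⟨i, Finset.mem_univ _, hf.pos _ hi⟩

/-- The functional `f ⊗ g` on a tensor product. -/
noncomputable def _root_.LinearMap.tensorFunctional {V W : Type*} [AddCommGroup V] [Module ℂ V]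
    [AddCommGroup W] [Module ℂ W] (f : V →ₗ[ℂ] ℂ) (g : W →ₗ[ℂ] ℂ) : V ⊗[ℂ] W →ₗ[ℂ] ℂ :=
  LinearMap.mul' ℂ ℂ ∘ₗ TensorProduct.map f g

@[simp] theorem _root_.LinearMap.tensorFunctional_tmul {V W : Type*} [AddCommGroup V] [Module ℂ V]
    [AddCommGroup W] [Module ℂ W] (f : V →ₗ[ℂ] ℂ) (g : W →ₗ[ℂ] ℂ) (v : V) (w : W) :
    f.tensorFunctional g (v ⊗ₜ w) = f v * g w := by
  simp [LinearMap.tensorFunctional]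

theorem tensor {L : Type*} [Ring L] [StarRing L] [Algebra ℂ L] [StarModule ℂ L]
    {f : K →ₗ[ℂ] ℂ} {g : L →ₗ[ℂ] ℂ} (hf : IsFaithfulPositive f) (hg : IsFaithfulPositive g) :
    IsFaithfulPositive (f.tensorFunctional g) where
  map_star z := by
    induction z with
    | zero => simp
    | tmul a b => simp [hf.map_star, hg.map_star]
    | add x y hx hy => simp [hx, hy]
  pos z hz := by
    obtain ⟨D, hD, hDt⟩ := hf.isInnerProduct.exists_tensor hg.isInnerProduct
    have key : ∀ x y, f.tensorFunctional g (star y * x) = D x y := by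
      intro x y
      induction x with
      | zero => simp
      | add x x' hx hx' => simp [mul_add, hx, hx']
      | tmul a b =>
        induction y with
        | zero => simp
        | add y y' hy hy' => simp [add_mul, hy, hy']
        | tmul c d => simp [hDt]
    rw [key]
    exact hD.pos z hz

end Algebra

end IsFaithfulPositive

/-! ## The Haar functional -/

section Haar

theorem trace_mulLeft_tensor {K : Type*} [Ring K] [Algebra ℂ K]
    [FiniteDimensional ℂ K] (z : K ⊗[ℂ] K) :
    LinearMap.trace ℂ _ (LinearMap.mulLeft ℂ z) =
      (regularTrace K).tensorFunctional (regularTrace K) z := by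
  induction z with
  | zero => simp
  | add x y hx hy => 
    have : LinearMap.mulLeft ℂ (x + y) = LinearMap.mulLeft ℂ x + LinearMap.mulLeft ℂ y := by
      ext; simp [add_mul]
    rw [this, map_add, map_add, hx, hy]
  | tmul a b =>
    have : LinearMap.mulLeft ℂ (a ⊗ₜ[ℂ] b) =
        TensorProduct.map (LinearMap.mulLeft ℂ a) (LinearMap.mulLeft ℂ b) := by
      ext; simp
    rw [this, LinearMap.trace_tensorProduct']
    simp [regularTrace_apply]

variable {K : Type*} [Ring K] [HopfAlgebra ℂ K]

/-- The Galois map `x ⊗ y ↦ Δ(x) (1 ⊗ y)`. -/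
noncomputable def galoisMap (K : Type*) [Ring K] [HopfAlgebra ℂ K] :
    K ⊗[ℂ] K →ₗ[ℂ] K ⊗[ℂ] K :=
  (LinearMap.mul' ℂ K).lTensor K ∘ₗ (TensorProduct.assoc ℂ K K K).toLinearMap ∘ₗ
    (Coalgebra.comul (R := ℂ) (A := K)).rTensor K

theorem galoisMap_tmul (x y : K) :
    galoisMap K (x ⊗ₜ y) = Coalgebra.comul (R := ℂ) x * (1 ⊗ₜ y) := by
  simp only [galoisMap, LinearMap.comp_apply, LinearMap.rTensor_tmul, LinearEquiv.coe_coe]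
  generalize Coalgebra.comul (R := ℂ) x = t
  induction t with
  | zero => simp
  | tmul a b => simp
  | add a b ha hb => simp [TensorProduct.add_tmul, add_mul, ha, hb]

/-- The map `x ⊗ y ↦ x₁ ⊗ S(x₂) y`. -/
noncomputable def galoisInv (K : Type*) [Ring K] [HopfAlgebra ℂ K] :
    K ⊗[ℂ] K →ₗ[ℂ] K ⊗[ℂ] K :=
  (LinearMap.mul' ℂ K ∘ₗ (HopfAlgebra.antipode ℂ (A := K)).rTensor K).lTensor K ∘ₗ
    (TensorProduct.assoc ℂ K K K).toLinearMap ∘ₗ (Coalgebra.comul (R := ℂ) (A := K)).rTensor K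

/-- By coassociativity the composite sends `x ⊗ y` to `x₁ ⊗ S(x₂) x₃ y`, which the antipode and
counit axioms collapse. A left inverse is enough in finite dimension. -/
theorem galoisInv_galoisMap (z : K ⊗[ℂ] K) : galoisInv K (galoisMap K z) = z := by
  induction z with
  | zero => simp
  | add x y hx hy => simp [hx, hy]
  | tmul x y =>
    have h1 : ∀ t : K ⊗[ℂ] K, galoisInv K (t * (1 ⊗ₜ y)) =
        (LinearMap.mulRight ℂ y ∘ₗ LinearMap.mul' ℂ K ∘ₗ
          (HopfAlgebra.antipode ℂ (A := K)).rTensor K).lTensor K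
        (TensorProduct.assoc ℂ K K K ((Coalgebra.comul (R := ℂ) (A := K)).rTensor K t)) := by
      intro t
      induction t with
      | zero => simp
      | add a b ha hb => simp [add_mul, ha, hb]
      | tmul a b =>
        simp only [galoisInv, LinearMap.comp_apply, Algebra.TensorProduct.tmul_mul_tmul, mul_one,
          LinearMap.rTensor_tmul, LinearEquiv.coe_coe]
        generalize Coalgebra.comul (R := ℂ) a = s
        induction s with
        | zero => simp
        | tmul c d => simp [mul_assoc]
        | add c d hc hd => simp only [TensorProduct.add_tmul, map_add, hc, hd]
    rw [galoisMap_tmul, h1, Coalgebra.coassoc_apply, ← LinearMap.comp_apply,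
      ← LinearMap.lTensor_comp, LinearMap.comp_assoc, LinearMap.comp_assoc,
      HopfAlgebra.mul_antipode_rTensor_comul]
    have h2 : LinearMap.mulRight ℂ y ∘ₗ Algebra.linearMap ℂ K ∘ₗ Coalgebra.counit =
        LinearMap.toSpanSingleton ℂ K y ∘ₗ Coalgebra.counit (R := ℂ) (A := K) := by
      ext a
      simp [Algebra.smul_def]
    rw [h2, LinearMap.lTensor_comp, LinearMap.comp_apply, Coalgebra.lTensor_counit_comul]
    simp

/-- The Galois map as a linear equivalence. -/
noncomputable def galoisEquiv (K : Type*) [Ring K] [HopfAlgebra ℂ K] [FiniteDimensional ℂ K] :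
    K ⊗[ℂ] K ≃ₗ[ℂ] K ⊗[ℂ] K :=
  LinearEquiv.ofInjectiveEndo (galoisMap K)
    (Function.LeftInverse.injective galoisInv_galoisMap)

variable [FiniteDimensional ℂ K]

/-- The Galois map intertwines left multiplication by `x ⊗ 1` with left multiplication by `Δ(x)`, so
both have the same trace; the first has trace `tr(x) tr(1)`, and `tr(1)` is the dimension. -/
theorem trace_comul (x : K) :
    (regularTrace K).tensorFunctional (regularTrace K) (Coalgebra.comul (R := ℂ) x) =
      Module.finrank ℂ K * regularTrace K x := by
  have h : (galoisEquiv K).conj (LinearMap.mulLeft ℂ (x ⊗ₜ[ℂ] (1 : K))) =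
      LinearMap.mulLeft ℂ (Coalgebra.comul (R := ℂ) x) := by
    have h' : (galoisMap K) ∘ₗ (LinearMap.mulLeft ℂ (x ⊗ₜ[ℂ] (1 : K))) =
        LinearMap.mulLeft ℂ (Coalgebra.comul (R := ℂ) x) ∘ₗ galoisMap K := by
      refine TensorProduct.ext' fun a b => ?_
      simp [galoisMap_tmul, mul_assoc]
    refine LinearMap.ext fun z => ?_
    obtain ⟨w, rfl⟩ := (galoisEquiv K).surjective z
    rw [LinearEquiv.conj_apply_apply, LinearEquiv.symm_apply_apply]
    exact LinearMap.congr_fun h' w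
  rw [← trace_mulLeft_tensor, ← h, LinearMap.trace_conj', trace_mulLeft_tensor]
  simp [mul_comm, regularTrace_apply]

end Haar

/-! ### From `(h ⊗ h)Δ = h` to invariance. -/

section Haar

/-- Invariance of a functional: `∑ h(x₁) x₂ = h(x) 1`. -/
def IsInvariantFunctional {K : Type*} [Ring K] [HopfAlgebra ℂ K] (h : K →ₗ[ℂ] ℂ) : Prop :=
  ∀ x : K, TensorProduct.lid ℂ K (h.rTensor K (Coalgebra.comul (R := ℂ) x)) = h x • (1 : K)

variable {K : Type*} [Ring K] [StarRing K] [HopfAlgebra ℂ K] [IsStarHopfAlgebra K]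

/-- The operator `T = (h ⊗ id)Δ` is idempotent and preserves `h`. For `a = T x`, the vector `w =
Δ(a) - 1 ⊗ a` has norm zero for `h ⊗ h`, hence `Δ(a) = 1 ⊗ a`. Applying `id ⊗ ε` makes `a` a scalar,
and `h` identifies that scalar as `h(x)`. -/
theorem IsFaithfulPositive.isInvariantFunctional {h : K →ₗ[ℂ] ℂ} (hh : IsFaithfulPositive h)
    (h_one : h 1 = 1)
    (h_comul : ∀ x, h.tensorFunctional h (Coalgebra.comul (R := ℂ) x) = h x) :
    IsInvariantFunctional h := by
  let T : K →ₗ[ℂ] K := (TensorProduct.lid ℂ K).toLinearMap ∘ₗ h.rTensor K ∘ₗ Coalgebra.comul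
  have hT : ∀ x, TensorProduct.lid ℂ K (h.rTensor K (Coalgebra.comul (R := ℂ) x)) = T x :=
    fun _ => rfl
  have hmul : ∀ (z : K ⊗[ℂ] K) (y : K), h.tensorFunctional h ((1 ⊗ₜ y) * z) =
      h (y * TensorProduct.lid ℂ K (h.rTensor K z)) := by
    intro z y
    induction z with
    | zero => simp
    | tmul a b => simp
    | add a b ha hb => simp [mul_add, ha, hb]
  have hhT : ∀ x, h (T x) = h x := fun x => by
    have := hmul (Coalgebra.comul (R := ℂ) x) 1
    rw [← Algebra.TensorProduct.one_def, one_mul, one_mul, h_comul, hT] at this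
    exact this.symm
  have hTT : ∀ x, T (T x) = T x := by
    have e1 : ∀ z : K ⊗[ℂ] K, T (TensorProduct.lid ℂ K (h.rTensor K z)) =
        TensorProduct.lid ℂ K (((h.tensorFunctional h).rTensor K)
          ((TensorProduct.assoc ℂ K K K).symm
            ((Coalgebra.comul (R := ℂ) (A := K)).lTensor K z))) := by
      intro z
      induction z with
      | zero => simp
      | add a b ha hb => simp [ha, hb]
      | tmul a b =>
        simp only [LinearMap.rTensor_tmul, LinearMap.lTensor_tmul, TensorProduct.lid_tmul, map_smul,
          T, LinearMap.comp_apply, LinearEquiv.coe_coe]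
        generalize Coalgebra.comul (R := ℂ) b = t
        induction t with
        | zero => simp
        | add c d hc hd => simp only [TensorProduct.tmul_add, map_add, smul_add, hc, hd]
        | tmul c d => simp [mul_smul]
    intro x
    rw [← hT x, e1, Coalgebra.coassoc_symm_apply, ← LinearMap.comp_apply,
      ← LinearMap.rTensor_comp]
    congr 3
    exact LinearMap.ext h_comul
  have hcomul : ∀ x, Coalgebra.comul (R := ℂ) (T x) = 1 ⊗ₜ T x := by
    intro x
    set a := T x with ha
    have haT : T a = a := hTT x
    set w := Coalgebra.comul (R := ℂ) a - 1 ⊗ₜ a with hw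
    by_contra hne
    have hw0 : w ≠ 0 := sub_ne_zero.2 hne
    have hpos := (hh.tensor hh).pos w hw0
    have t1 : h.tensorFunctional h ((1 ⊗ₜ star a) * Coalgebra.comul (R := ℂ) a) =
        h (star a * a) := by
      rw [hmul, hT, haT]
    have t2 : h.tensorFunctional h (star (Coalgebra.comul (R := ℂ) a) * (1 ⊗ₜ a)) =
        h (star a * a) := by
      have : star (Coalgebra.comul (R := ℂ) a) * ((1 : K) ⊗ₜ[ℂ] a) =
          star ((1 ⊗ₜ star a) * Coalgebra.comul (R := ℂ) a) := by simp
      rw [this, (hh.tensor hh).map_star, t1, ← hh.map_star]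
      simp
    have t3 : h.tensorFunctional h (star (Coalgebra.comul (R := ℂ) a) *
        Coalgebra.comul (R := ℂ) a) = h (star a * a) := by
      rw [← IsStarHopfAlgebra.comul_star, ← Bialgebra.comul_mul, h_comul]
    -- All four terms of the expansion equal `h(a^* a)`, the last one because `h(1) = 1`, and they
    -- enter with signs `+ - - +`.
    have : h.tensorFunctional h (star w * w) = 0 := by
      rw [hw, star_sub, sub_mul, mul_sub, mul_sub, map_sub, map_sub, map_sub, t3, t2]
      simp only [TensorProduct.star_tmul, star_one, t1]
      simp [h_one]
    rw [this] at hpos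
    simp at hpos
  intro x
  have hx : T x = Coalgebra.counit (R := ℂ) (T x) • (1 : K) := by
    have := congrArg (TensorProduct.rid ℂ K) (congrArg
      ((Coalgebra.counit (R := ℂ) (A := K)).lTensor K) (hcomul x))
    rw [Coalgebra.lTensor_counit_comul] at this
    simpa using this
  have hc : h x = Coalgebra.counit (R := ℂ) (T x) := by
    have := congrArg h hx
    rwa [hhT, map_smul, h_one, smul_eq_mul, mul_one] at this
  rw [hT, hc, ← hx]

theorem IsFaithfulPositive.exists_isInvariantFunctional [FiniteDimensional ℂ K]
    {f : K →ₗ[ℂ] ℂ} (hf : IsFaithfulPositive f) :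
    ∃ h : K →ₗ[ℂ] ℂ, IsFaithfulPositive h ∧ IsInvariantFunctional h := by
  have : Nontrivial K := ⟨⟨1, 0, fun h => by
    simpa using congrArg (Coalgebra.counit (R := ℂ)) h⟩⟩
  have hd : 0 < Module.finrank ℂ K := Module.finrank_pos
  have hd' : (Module.finrank ℂ K : ℂ) ≠ 0 := by exact_mod_cast hd.ne'
  -- Dividing by the dimension gives both `h(1) = 1` and, through `trace_comul`, `(h ⊗ h)Δ = h`.
  have hpos := hf.trace.smul (r := (Module.finrank ℂ K : ℝ)⁻¹) (by positivity)
  refine ⟨_, hpos, hpos.isInvariantFunctional ?_ fun x => ?_⟩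
  · simp [regularTrace_apply, hd']
  · have h1 : ∀ (c : ℂ) (g : K →ₗ[ℂ] ℂ) (z : K ⊗[ℂ] K), (c • g).tensorFunctional (c • g) z =
        c * c * g.tensorFunctional g z := by
      intro c g z
      induction z with
      | zero => simp
      | tmul a b => simp; ring
      | add a b ha hb => simp only [map_add, ha, hb, mul_add]
    rw [h1, trace_comul]
    simp
    field_simp

end Haar

/-! ## Unitarizability of comodules -/

section Unitary

variable {K V : Type*} [Ring K] [HopfAlgebra ℂ K] [AddCommGroup V] [Module ℂ V]

@[simp] theorem RightComodule.contractLeft_tmul (B : V →ₗ[ℂ] V →ₗ⋆[ℂ] ℂ) (v w : V) (x : K) :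
    RightComodule.contractLeft B v (w ⊗ₜ x) = B w v • HopfAlgebra.antipode ℂ x := rfl

theorem RightComodule.contractLeft_pullback {W : Type*} [AddCommGroup W] [Module ℂ W]
    (B : W →ₗ[ℂ] W →ₗ⋆[ℂ] ℂ) (f : V →ₗ[ℂ] W) (v : V) (z : V ⊗[ℂ] K) :
    RightComodule.contractLeft (B.sesqPullback f) v z =
      RightComodule.contractLeft B (f v) (f.rTensor K z) := by
  induction z with
  | zero => simp
  | tmul a b => simp
  | add a b ha hb => simp [ha, hb]

theorem RightComodule.coact_injective (ρ : RightComodule K V) :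
    Function.Injective ρ.coact := fun u v h => by
  have e := fun w => LinearMap.congr_fun ρ.counit_coact w
  simp only [LinearMap.comp_apply, LinearMap.id_apply] at e
  rw [← e u, h, e v]

variable [StarRing K] [IsStarHopfAlgebra K]

@[simp] theorem RightComodule.contractRight_tmul (B : V →ₗ[ℂ] V →ₗ⋆[ℂ] ℂ) (u w : V) (x : K) :
    RightComodule.contractRight B u (w ⊗ₜ x) = B u w • star x := rfl

theorem RightComodule.contractRight_pullback {W : Type*} [AddCommGroup W] [Module ℂ W]
    (B : W →ₗ[ℂ] W →ₗ⋆[ℂ] ℂ) (f : V →ₗ[ℂ] W) (v : V) (z : V ⊗[ℂ] K) :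
    RightComodule.contractRight (B.sesqPullback f) v z =
      RightComodule.contractRight B (f v) (f.rTensor K z) := by
  induction z with
  | zero => simp
  | tmul a b => simp
  | add a b ha hb => simp [ha, hb]

open IsFaithfulPositive in
-- Invariance at `b^* a₁` turns `h(b^* a₁) S(a₂)` into `h(b₁^* a₁) b₂^* a₂ S(a₃)`, and `a₂ S(a₃)`
-- cancels to leave `h(b₁^* a) b₂^*`. Below, `G` is the expression after invariance is used and `F`
-- the one after regrouping by coassociativity.
theorem IsInvariantFunctional.contract_comul {h : K →ₗ[ℂ] ℂ} (hh : IsInvariantFunctional h)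
    (a b : K) :
    RightComodule.contractLeft (form h) b (Coalgebra.comul (R := ℂ) a) =
      RightComodule.contractRight (form h) a (Coalgebra.comul (R := ℂ) b) := by
  have hstar : ∀ z : K ⊗[ℂ] K, RightComodule.contractRight (form h) a z =
      TensorProduct.lid ℂ K (h.rTensor K (star z * (a ⊗ₜ 1))) := by
    intro z
    induction z with
    | zero => simp
    | tmul c d => simp
    | add c d hc hd => simp [add_mul, hc, hd]
  let G : K ⊗[ℂ] K →ₗ[ℂ] K := LinearMap.mul' ℂ K ∘ₗ TensorProduct.map
    ((TensorProduct.lid ℂ K).toLinearMap ∘ₗ h.rTensor K ∘ₗ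
      LinearMap.mulLeft ℂ (Coalgebra.comul (R := ℂ) (star b)) ∘ₗ Coalgebra.comul)
    (HopfAlgebra.antipode ℂ)
  have hL : ∀ z : K ⊗[ℂ] K, RightComodule.contractLeft (form h) b z = G z := by
    intro z
    induction z with
    | zero => simp
    | add c d hc hd => simp only [map_add, hc, hd]
    | tmul c d =>
      simp only [G, LinearMap.comp_apply, TensorProduct.map_tmul, LinearMap.mulLeft_apply,
        ← Bialgebra.comul_mul, LinearEquiv.coe_coe, hh (star b * c)]
      simp
  let F : K ⊗[ℂ] (K ⊗[ℂ] K) →ₗ[ℂ] K := (TensorProduct.lid ℂ K).toLinearMap ∘ₗ h.rTensor K ∘ₗ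
    LinearMap.mulLeft ℂ (Coalgebra.comul (R := ℂ) (star b)) ∘ₗ
      (LinearMap.mul' ℂ K ∘ₗ (HopfAlgebra.antipode ℂ (A := K)).lTensor K).lTensor K
  have hG : ∀ z : K ⊗[ℂ] K, G z = F (TensorProduct.assoc ℂ K K K
      ((Coalgebra.comul (R := ℂ) (A := K)).rTensor K z)) := by
    intro z
    induction z with
    | zero => simp
    | add c d hc hd => simp only [map_add, hc, hd]
    | tmul c d =>
      simp only [G, F, LinearMap.comp_apply, TensorProduct.map_tmul, LinearMap.mulLeft_apply,
        LinearEquiv.coe_coe, LinearMap.rTensor_tmul]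
      generalize Coalgebra.comul (R := ℂ) c = t
      generalize Coalgebra.comul (R := ℂ) (star b) = s
      induction t with
      | zero => simp
      | add x y hx hy => simp only [TensorProduct.add_tmul, mul_add, map_add, hx, hy]
      | tmul x y =>
        induction s with
        | zero => simp
        | add x y hx hy => simp only [TensorProduct.add_tmul, add_mul, map_add, hx, hy]
        | tmul z w => simp [mul_assoc]
  rw [hL, hG, Coalgebra.coassoc_apply, hstar, ← IsStarHopfAlgebra.comul_star]
  simp only [F, LinearMap.comp_apply]
  rw [← LinearMap.comp_apply (LinearMap.lTensor K _) (LinearMap.lTensor K _),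
    ← LinearMap.lTensor_comp, LinearMap.comp_assoc, HopfAlgebra.mul_antipode_lTensor_comul,
    LinearMap.lTensor_comp, LinearMap.comp_apply,
    Coalgebra.lTensor_counit_comul]
  simp

open IsFaithfulPositive in
-- This is invariance on the cofree comodule `V ⊗ K`: the coaction touches only `K`, so the form on
-- `V` enters as a scalar factor.
theorem IsInvariantFunctional.contract_cofree {h : K →ₗ[ℂ] ℂ} (hh : IsInvariantFunctional h)
    {C : V →ₗ[ℂ] V →ₗ⋆[ℂ] ℂ} {D : V ⊗[ℂ] K →ₗ[ℂ] V ⊗[ℂ] K →ₗ⋆[ℂ] ℂ}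
    (hD : ∀ v a w b, D (v ⊗ₜ a) (w ⊗ₜ b) = C v w * form h a b) (z w : V ⊗[ℂ] K) :
    RightComodule.contractLeft D w ((TensorProduct.assoc ℂ V K K).symm
        ((Coalgebra.comul (R := ℂ) (A := K)).lTensor V z)) =
      RightComodule.contractRight D z ((TensorProduct.assoc ℂ V K K).symm
        ((Coalgebra.comul (R := ℂ) (A := K)).lTensor V w)) := by
  -- The contractions are bundled as maps in the tensor only; induction on `z` and `w` also needs
  -- additivity in the vector argument.
  have addL : ∀ w w' (t : (V ⊗[ℂ] K) ⊗[ℂ] K), RightComodule.contractLeft D (w + w') t =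
      RightComodule.contractLeft D w t + RightComodule.contractLeft D w' t := by
    intro w w' t
    induction t with
    | zero => simp
    | tmul a b => simp [add_smul]
    | add a b ha hb => simp only [map_add, ha, hb]; abel
  have addR : ∀ w w' (t : (V ⊗[ℂ] K) ⊗[ℂ] K), RightComodule.contractRight D (w + w') t =
      RightComodule.contractRight D w t + RightComodule.contractRight D w' t := by
    intro w w' t
    induction t with
    | zero => simp
    | tmul a b => simp [add_smul]
    | add a b ha hb => simp only [map_add, ha, hb]; abel
  have zeroL : ∀ t : (V ⊗[ℂ] K) ⊗[ℂ] K, RightComodule.contractLeft D 0 t = 0 := fun t => by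
    simpa using addL 0 0 t
  have zeroR : ∀ t : (V ⊗[ℂ] K) ⊗[ℂ] K, RightComodule.contractRight D 0 t = 0 := fun t => by
    simpa using addR 0 0 t
  induction z with
  | zero => simp [zeroR]
  | add z z' hz hz' => simp only [map_add, addR, hz, hz']
  | tmul v a =>
    induction w with
    | zero => simp [zeroL]
    | add z z' hz hz' => simp only [map_add, addL, hz, hz']
    | tmul w b =>
      have eL : ∀ t : K ⊗[ℂ] K, RightComodule.contractLeft D (w ⊗ₜ b)
          ((TensorProduct.assoc ℂ V K K).symm (v ⊗ₜ t)) =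
          C v w • RightComodule.contractLeft (form h) b t := by
        intro t
        induction t with
        | zero => simp
        | tmul x y => simp [hD, mul_smul]
        | add x y hx hy => simp only [TensorProduct.tmul_add, map_add, smul_add, hx, hy]
      have eR : ∀ t : K ⊗[ℂ] K, RightComodule.contractRight D (v ⊗ₜ a)
          ((TensorProduct.assoc ℂ V K K).symm (w ⊗ₜ t)) =
          C v w • RightComodule.contractRight (form h) a t := by
        intro t
        induction t with
        | zero => simp
        | tmul x y => simp [hD, mul_smul]
        | add x y hx hy => simp only [TensorProduct.tmul_add, map_add, smul_add, hx, hy]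
      rw [LinearMap.lTensor_tmul, LinearMap.lTensor_tmul, eL, eR, hh.contract_comul]

/-- Coassociativity makes the coaction a comodule map into the cofree comodule, and the counit axiom
makes it injective, so the invariant inner product there restricts to `V`. -/
theorem RightComodule.exists_isInvariant (ρ : RightComodule K V) {h : K →ₗ[ℂ] ℂ}
    (hpos : IsFaithfulPositive h) (hinv : IsInvariantFunctional h) :
    ∃ B : V →ₗ[ℂ] V →ₗ⋆[ℂ] ℂ, IsInnerProduct B ∧ ρ.IsInvariant B := by
  obtain ⟨C, hC⟩ := IsInnerProduct.exists_isInnerProduct V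
  obtain ⟨D, hD, hDt⟩ := hC.exists_tensor hpos.isInnerProduct
  refine ⟨D.sesqPullback ρ.coact, hD.pullback ρ.coact_injective, fun u v => ?_⟩
  have e : ∀ w, ρ.coact.rTensor K (ρ.coact w) = (TensorProduct.assoc ℂ V K K).symm
      ((Coalgebra.comul (R := ℂ) (A := K)).lTensor V (ρ.coact w)) := fun w =>
    (LinearEquiv.eq_symm_apply _).2 (LinearMap.congr_fun ρ.coassoc w)
  rw [RightComodule.contractLeft_pullback, RightComodule.contractRight_pullback, e, e]
  exact hinv.contract_cofree hDt _ _

end Unitary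

theorem IsFaithfulPositive.isCQG {K : Type u} [Ring K] [StarRing K] [HopfAlgebra ℂ K]
    [IsStarHopfAlgebra K] [FiniteDimensional ℂ K] {f : K →ₗ[ℂ] ℂ} (hf : IsFaithfulPositive f) :
    IsCQG.{v} K := fun V _ _ ρ => by
  obtain ⟨h, hpos, hinv⟩ := hf.exists_isInvariantFunctional
  exact ρ.exists_isInvariant hpos hinv

/-! ### The regular comodule and its invariant inner product. -/

section Regular

variable {H : Type u} [Ring H] [HopfAlgebra ℂ H]

/-- The regular comodule `H`, transported along a linear equivalence. -/
noncomputable def RightComodule.regular {W : Type*} [AddCommGroup W] [Module ℂ W]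
    (e : W ≃ₗ[ℂ] H) : RightComodule H W where
  coact := e.symm.toLinearMap.rTensor H ∘ₗ Coalgebra.comul ∘ₗ e.toLinearMap
  coassoc := by
    ext1 w
    have h1 : ∀ t : H ⊗[ℂ] H, TensorProduct.assoc ℂ W H H
        ((e.symm.toLinearMap.rTensor H ∘ₗ Coalgebra.comul ∘ₗ e.toLinearMap).rTensor H
          (e.symm.toLinearMap.rTensor H t)) =
        e.symm.toLinearMap.rTensor (H ⊗[ℂ] H) (TensorProduct.assoc ℂ H H H
          ((Coalgebra.comul (R := ℂ) (A := H)).rTensor H t)) := by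
      intro t
      induction t with
      | zero => simp
      | add a b ha hb => simp only [map_add, ha, hb]
      | tmul a b =>
        simp only [LinearMap.rTensor_tmul, LinearMap.comp_apply, LinearEquiv.coe_coe,
          LinearEquiv.apply_symm_apply]
        generalize Coalgebra.comul (R := ℂ) a = s
        induction s with
        | zero => simp
        | tmul c d => simp
        | add c d hc hd => simp only [map_add, TensorProduct.add_tmul, hc, hd]
    have h2 : ∀ t : H ⊗[ℂ] H, (Coalgebra.comul (R := ℂ) (A := H)).lTensor W
        (e.symm.toLinearMap.rTensor H t) = e.symm.toLinearMap.rTensor (H ⊗[ℂ] H)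
          ((Coalgebra.comul (R := ℂ) (A := H)).lTensor H t) := by
      intro t
      induction t with
      | zero => simp
      | tmul a b => simp
      | add a b ha hb => simp only [map_add, ha, hb]
    have h1' := h1 (Coalgebra.comul (R := ℂ) (e w))
    rw [Coalgebra.coassoc_apply, ← h2] at h1'
    exact h1'
  counit_coact := by
    ext1 w
    have h2 : ∀ t : H ⊗[ℂ] H, (Coalgebra.counit (R := ℂ) (A := H)).lTensor W
        (e.symm.toLinearMap.rTensor H t) = e.symm.toLinearMap.rTensor ℂ
          ((Coalgebra.counit (R := ℂ) (A := H)).lTensor H t) := by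
      intro t
      induction t with
      | zero => simp
      | tmul a b => simp
      | add a b ha hb => simp only [map_add, ha, hb]
    simp only [LinearMap.comp_apply, h2, LinearEquiv.coe_coe, Coalgebra.lTensor_counit_comul]
    simp

theorem RightComodule.regular_coact {W : Type*} [AddCommGroup W] [Module ℂ W]
    (e : W ≃ₗ[ℂ] H) (w : W) : (RightComodule.regular e).coact w =
      e.symm.toLinearMap.rTensor H (Coalgebra.comul (R := ℂ) (e w)) := rfl

theorem IsCQG.exists_form [StarRing H] [IsStarHopfAlgebra H] [FiniteDimensional ℂ H]
    (hH : IsCQG.{v} H) : ∃ B : H →ₗ[ℂ] H →ₗ⋆[ℂ] ℂ, IsInnerProduct B ∧ ∀ u v : H,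
      RightComodule.contractLeft B v (Coalgebra.comul (R := ℂ) u) =
        RightComodule.contractRight B u (Coalgebra.comul (R := ℂ) v) := by
  -- `IsCQG.{v}` covers only comodules in `Type v`, while `H` lives in `Type u`; a coordinate copy
  -- of `H` is placed in the right universe.
  let e : ULift.{v} (Fin (Module.finrank ℂ H) → ℂ) ≃ₗ[ℂ] H :=
    ULift.moduleEquiv.trans (Module.finBasis ℂ H).equivFun.symm
  obtain ⟨B, hB, hinv⟩ := hH _ (RightComodule.regular e)
  refine ⟨B.sesqPullback e.symm.toLinearMap, hB.pullback e.symm.injective, fun u v => ?_⟩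
  have := hinv (e.symm u) (e.symm v)
  rw [RightComodule.regular_coact, RightComodule.regular_coact, e.apply_symm_apply,
    e.apply_symm_apply] at this
  rw [RightComodule.contractLeft_pullback, RightComodule.contractRight_pullback]
  exact this

end Regular

/-! ### The action of the dual on `H`. -/

namespace HopfDual

variable {H : Type u} [Ring H] [HopfAlgebra ℂ H]

/-- The action `β · x = ∑ x₁ β(x₂)` of the dual on `H`. -/
noncomputable def act (β : HopfDual H) : H →ₗ[ℂ] H :=
  (TensorProduct.rid ℂ H).toLinearMap ∘ₗ (toDual H β).lTensor H ∘ₗ Coalgebra.comul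

theorem act_eq (β : HopfDual H) (x : H) :
    act β x = TensorProduct.rid ℂ H ((toDual H β).lTensor H (Coalgebra.comul (R := ℂ) x)) := rfl

/-- This makes the action faithful: `β` is recovered from `act β`. -/
theorem counit_act (β : HopfDual H) (x : H) : Coalgebra.counit (R := ℂ) (act β x) = β x := by
  have h : ∀ t : H ⊗[ℂ] H, Coalgebra.counit (R := ℂ)
      (TensorProduct.rid ℂ H ((toDual H β).lTensor H t)) =
      β (TensorProduct.lid ℂ H ((Coalgebra.counit (R := ℂ) (A := H)).rTensor H t)) := by
    intro t
    induction t with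
    | zero => simp
    | tmul a b => simp [mul_comm]
    | add a b ha hb => simp [ha, hb]
  rw [act_eq, h, Coalgebra.rTensor_counit_comul]
  simp

theorem act_mul (α β : HopfDual H) (x : H) : act (α * β) x = act α (act β x) := by
  have h1 : ∀ t : H ⊗[ℂ] H, act α (TensorProduct.rid ℂ H ((toDual H β).lTensor H t)) =
      TensorProduct.rid ℂ H ((TensorProduct.dualDistrib ℂ H H (toDual H α ⊗ₜ toDual H β)).lTensor H
        (TensorProduct.assoc ℂ H H H ((Coalgebra.comul (R := ℂ) (A := H)).rTensor H t))) := by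
    intro t
    induction t with
    | zero => simp
    | add a b ha hb => simp only [map_add, ha, hb]
    | tmul a b =>
      simp only [LinearMap.lTensor_tmul, LinearMap.rTensor_tmul, TensorProduct.rid_tmul, map_smul,
        act_eq]
      generalize Coalgebra.comul (R := ℂ) a = s
      induction s with
      | zero => simp
      | add c d hc hd => simp only [map_add, TensorProduct.add_tmul, smul_add, hc, hd]
      | tmul c d => simp [smul_smul, mul_comm]
  rw [act_eq β, h1, Coalgebra.coassoc_apply, ← LinearMap.comp_apply (LinearMap.lTensor H _),
    ← LinearMap.lTensor_comp]
  rfl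

theorem act_linear (x : H) : ∃ L : HopfDual H →ₗ[ℂ] H, ∀ β, L β = act β x := by
  refine ⟨{ toFun := fun β => act β x, map_add' := fun α β => ?_, map_smul' := fun c β => ?_ },
    fun _ => rfl⟩
  · simp [act_eq, LinearMap.lTensor_add]
  · simp [act_eq, LinearMap.lTensor_smul]

/-! ## Evaluation into the double dual -/

section Eval

variable [Module.Finite ℂ H]

instance : Module.Finite ℂ (HopfDual H) := Module.Finite.equiv (toDual H).symm

/-- The evaluation map into the double dual. -/
noncomputable def eval (H : Type u) [Ring H] [HopfAlgebra ℂ H] [Module.Finite ℂ H] :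
    H →ₗ[ℂ] HopfDual (HopfDual H) :=
  (toDual (HopfDual H)).symm.toLinearMap ∘ₗ (toDual H).toLinearMap.dualMap ∘ₗ Module.Dual.eval ℂ H

@[simp] theorem eval_apply (x : H) (α : HopfDual H) : eval H x α = α x := rfl

theorem eval_injective : Function.Injective (eval H) :=
  (injective_iff_map_eq_zero _).2 fun x hx => by
    rw [← Module.forall_dual_apply_eq_zero_iff ℂ]
    exact fun α => congrArg (fun F : HopfDual (HopfDual H) => F ((toDual H).symm α)) hx

theorem eval_mul (x y : H) : eval H (x * y) = eval H x * eval H y := by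
  ext α
  rw [mul_apply_repr _ _ (Coalgebra.Repr.arbitrary ℂ α), eval_apply, ← tensorEquiv_comul]
  conv_lhs => rw [← (Coalgebra.Repr.arbitrary ℂ α).eq]
  simp

end Eval

/-! ## Unitarity of the action on a compact quantum group -/

theorem apply_contractLeft [Module.Finite ℂ H] (α : HopfDual H) (B : H →ₗ[ℂ] H →ₗ⋆[ℂ] ℂ) (v : H)
    (z : H ⊗[ℂ] H) : α (RightComodule.contractLeft B v z) =
      B (TensorProduct.rid ℂ H ((toDual H (HopfAlgebra.antipode ℂ α)).lTensor H z)) v := by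
  induction z with
  | zero => simp
  | tmul a b => simp [mul_comm]
  | add a b ha hb => simp [ha, hb]

variable [StarRing H] [IsStarHopfAlgebra H]

theorem apply_contractRight (α : HopfDual H) (B : H →ₗ[ℂ] H →ₗ⋆[ℂ] ℂ) (u : H)
    (z : H ⊗[ℂ] H) : α (RightComodule.contractRight B u z) =
      B u (TensorProduct.rid ℂ H ((toDual H (conjStar α)).lTensor H z)) := by
  induction z with
  | zero => simp
  | tmul a b => simp [mul_comm, conjStar_apply]
  | add a b ha hb => simp [ha, hb]

theorem conjStar_conjStar (α : HopfDual H) : conjStar (conjStar α) = α := by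
  ext x
  simp [conjStar_apply]

/-- The invariance identity is evaluated at the functional `conjStar (star β)`. On the left the
antipode turns it into `star (star β) = β`; on the right conjugation turns it back into `star β`. -/
theorem form_act [Module.Finite ℂ H] {B : H →ₗ[ℂ] H →ₗ⋆[ℂ] ℂ} (hB : ∀ u v : H,
      RightComodule.contractLeft B v (Coalgebra.comul (R := ℂ) u) =
        RightComodule.contractRight B u (Coalgebra.comul (R := ℂ) v))
    (β : HopfDual H) (u v : H) : B (act β u) v = B u (act (star β) v) := by
  have h := congrArg (conjStar (star β)) (hB u v)
  rw [apply_contractLeft, apply_contractRight, conjStar_conjStar, ← starFun_eq] at h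
  have : starFun (star β) = β := star_star β
  rw [this] at h
  exact h

theorem _root_.IsCQG.exists_isFaithfulPositive [Module.Finite ℂ H] (hH : IsCQG.{v} H) :
    ∃ f : HopfDual H →ₗ[ℂ] ℂ, IsFaithfulPositive f := by
  obtain ⟨B, hB, hinv⟩ := hH.exists_form
  have hact := form_act hinv
  choose L hL using act_linear (H := H)
  -- Any basis will do: hermiticity and positivity hold term by term, and faithfulness only needs
  -- the `b i` to span.
  let b := Module.finBasis ℂ H
  let f : HopfDual H →ₗ[ℂ] ℂ := ∑ i, B.flip (b i) ∘ₗ L (b i)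
  have hf : ∀ β, f β = ∑ i, B (act β (b i)) (b i) := fun β => by simp [f, hL]
  refine ⟨f, fun β => ?_, fun β hβ => ?_⟩
  · rw [hf, hf, map_sum]
    refine Finset.sum_congr rfl fun i _ => ?_
    rw [hact, star_star, hB.conj_symm]
  · have hnn : ∀ u, 0 ≤ (B u u).re := fun u => by
      by_cases hu : u = 0
      · simp [hu]
      · exact (hB.pos u hu).le
    have hsq : ∀ i, B (act (star β * β) (b i)) (b i) = B (act β (b i)) (act β (b i)) :=
      fun i => by rw [act_mul, hact, star_star]
    rw [hf, Complex.re_sum]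
    simp only [hsq]
    obtain ⟨i, hi⟩ : ∃ i, act β (b i) ≠ 0 := by
      by_contra! h
      have h0 : act β = 0 := b.ext h
      exact hβ (HopfDual.ext fun x => by rw [← counit_act, h0]; simp)
    exact Finset.sum_pos' (fun i _ => hnn _) ⟨i, Finset.mem_univ _, hB.pos _ hi⟩

variable [Module.Finite ℂ H]

/-- Unfolding both dual involutions, the right side at `α` is `α(S(S(x)^*))`, and `S(S(x)^*) = x^*`.
-/
theorem eval_star (x : H) : eval H (star x) = star (eval H x) := by
  have h := IsStarHopfAlgebra.antipode_star_antipode_star (star x)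
  rw [star_star] at h
  ext α
  simp [h]

theorem _root_.IsFaithfulPositive.of_double_dual {F : HopfDual (HopfDual H) →ₗ[ℂ] ℂ}
    (hF : IsFaithfulPositive F) : IsFaithfulPositive (F ∘ₗ eval H) where
  map_star x := by simp [eval_star, hF.map_star]
  pos x hx := by
    have := hF.pos (eval H x) ((map_ne_zero_iff _ eval_injective).2 hx)
    simpa [eval_star, eval_mul] using this

end HopfDual

theorem mainTheorem11 (H : Type u) [Ring H] [StarRing H] [HopfAlgebra ℂ H] [IsStarHopfAlgebra H]
    [FiniteDimensional ℂ H] :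
    IsCQG.{v} H ↔ IsCQG.{v} (HopfDual H) := by
  refine ⟨fun h => ?_, fun h => ?_⟩
  · obtain ⟨f, hf⟩ := h.exists_isFaithfulPositive
    exact hf.isCQG
  -- Here `f` lives on the double dual and is pulled back to `H` along `eval`.
  · obtain ⟨f, hf⟩ := h.exists_isFaithfulPositive
    exact hf.of_double_dual.isCQG
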